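/- Let $M$ be a smooth (Hausdorff) $n$-dimensional real manifold and $\nabla$ a smooth connection on $TM$. For $k\ge 0$ let $\Omega^k(M,TM)$ be the space of $TM$-valued differential $k$-forms, regarded as alternating $C^\infty(M)$-multilinear maps from smooth vector fields to smooth vector fields. For an endomorphism $L$ of $TM$ (a smooth $(1,1)$-tensor field) put $[X,Y]_L=[LX,Y]+[X,LY]-L[X,Y]$, and define the $L$-exterior covariant derivative $d_{L\nabla}:\Omega^k(M,TM)\to\Omega^{k+1}(M,TM)$ by $$(d_{L\nabla}\omega)(X_0,\dots,X_k)=\sum_{i=0}^k(-1)^i\,\nabla_{LX_i}\big(\omega(X_0,\dots,\hat X_i,\dots,X_k)\big)+\sum_{0\le i<j\le k}(-1)^{i+j}\,\omega([X_i,X_j]_L,X_0,\dots,\hat X_i,\dots,\hat X_j,\dots,X_k).$$ Let $d_\nabla$ be given by the same formula with $\nabla_{X_i}$ in place of $\nabla_{LX_i}$ and $[X_i,X_j]$ in place of $[X_i,X_j]_L$. On scalar-valued forms, $d_L$ is given by the same formula with the derivative of a function along $LX_i$ in place of $\nabla_{LX_i}$. The connection $\nabla$ is flat if $\nabla_X\nabla_YZ-\nabla_Y\nabla_XZ-\nabla_{[X,Y]}Z=0$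 for all vector fields $X,Y,Z$, and $L$ is torsionless if its Nijenhuis torsion vanishes: $[LX,LY]-L[X,LY]-L[LX,Y]+L^2[X,Y]=0$ for all $X,Y$. Then: 1. On scalar-valued forms (with the trivial connection $\nabla_Xf=X(f)$ in the definition) $d_{L\nabla}$ coincides with $d_L$. 2. If $Z$ is a vector field, seen as a $0$-form with values in $TM$, then $(d_{L\nabla}Z)(X)=\nabla_{LX}Z$ for every vector field $X$. 3. If $L=I$ is the identity endomorphism, then $d_{L\nabla}=d_\nabla$. 4. If $\nabla$ is flat and $L$ is torsionless, then $d_{L\nabla}\circ d_{L\nabla}=0$. 5. For all endomorphisms $L,N$ of $TM$, $d_{(L+N)\nabla}=d_{L\nabla}+d_{N\nabla}$. 6. If $\nabla$ is flat and $L$, $N$ and $L+N$ are torsionless, then $(\Omega^*(M,TM),d_{L\nabla},d_{N\nabla})$ is a bidifferential complex: $d_{L\nabla}\circ d_{L\nabla}=0$, $d_{N\nabla}\circ d_{N\nabla}=0$ and $d_{L\nabla}\circ d_{N\nabla}+d_{N\nabla}\circ d_{L\nabla}=0$. 7. In particular, if $\nabla$ is flat and $L$ is torsionless, then $(\Omega^*(M,TM),d_\nabla,d_{L\nabla})$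 is a bidifferential complex. -/

import Mathlib

open scoped Manifold ContDiff

set_option linter.unusedSectionVars false
namespace Bicomplex

section Formula

variable {S P : Type*} [AddCommGroup P]

/-- The sum `∑_i (-1)^i D_{X_i} (α(X_0, …, X̂_i, …, X_k))`. -/
def derivSum (D : S → P → P) {k : ℕ} (α : (Fin k → S) → P) (X : Fin (k + 1) → S) : P :=
  ∑ i : Fin (k + 1), (-1 : ℤ) ^ (i : ℕ) • D (X i) (α (i.removeNth X))

/-- The sum `∑_{i<j} (-1)^{i+j} α([X_i, X_j], X_0, …, X̂_i, …, X̂_j, …, X_k)` over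
`0 ≤ i < j ≤ k`, which is empty for `k = 0`. For `k = m + 1` the pairs `i < j` of the informal
formula are written as `(i.castSucc, j.succ)` with `i ≤ j` in `Fin (m + 1)`, whence the exponent
`i + (j + 1)`; once `X_i` is removed, the entry `X_{j + 1}` has index `j`. -/
def bracketSum (br : S → S → S) : {k : ℕ} → ((Fin k → S) → P) → (Fin (k + 1) → S) → P
  | 0, _, _ => 0
  | m + 1, α, X => ∑ i : Fin (m + 1), ∑ j ∈ Finset.Ici i, (-1 : ℤ) ^ ((i : ℕ) + ((j : ℕ) + 1)) •
      α (Matrix.vecCons (br (X i.castSucc) (X j.succ)) (j.removeNth (i.castSucc.removeNth X)))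

/-- The sum of `derivSum` and `bracketSum`: the Cartan formula for exterior derivatives. -/
def cartanFormula (br : S → S → S) (D : S → P → P) {k : ℕ} (α : (Fin k → S) → P)
    (X : Fin (k + 1) → S) : P :=
  derivSum D α X + bracketSum br α X

end Formula

section Alternating

variable {R S P : Type*} [CommRing R] [Algebra ℝ R]
  [AddCommGroup S] [Module R S] [Module ℝ S] [IsScalarTower ℝ R S]
  [AddCommGroup P] [Module R P] [Module ℝ P] [IsScalarTower ℝ R P]

/-- Restriction of scalars of an alternating map from `R` to `ℝ`. -/
def toReal {k : ℕ} (α : S [⋀^Fin k]→ₗ[R] P) : S [⋀^Fin k]→ₗ[ℝ] P :=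
  { α.toMultilinearMap.restrictScalars ℝ with
    map_eq_zero_of_eq' := α.map_eq_zero_of_eq' }

theorem derivSum_alt (D : S →ₗ[ℝ] P →ₗ[ℝ] P) {k : ℕ} (α : S [⋀^Fin k]→ₗ[R] P) :
    ∃ η : S [⋀^Fin (k + 1)]→ₗ[ℝ] P, ∀ X, η X = derivSum (fun x p => D x p) α X := by
  let f : S →ₗ[ℝ] S [⋀^Fin k]→ₗ[ℝ] P :=
    { toFun := fun x => (D x).compAlternatingMap (toReal α)
      map_add' := by intros; ext; simp
      map_smul' := by intros; ext; simp }
  refine ⟨AlternatingMap.alternatizeUncurryFin f, fun X => ?_⟩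
  rw [AlternatingMap.alternatizeUncurryFin_apply]
  rfl

theorem bracketSum_alt (br : S →ₗ[ℝ] S →ₗ[ℝ] S) (hbr : ∀ x y, br x y = - br y x) :
    ∀ {k : ℕ} (α : S [⋀^Fin k]→ₗ[R] P),
    ∃ η : S [⋀^Fin (k + 1)]→ₗ[ℝ] P, ∀ X, η X = bracketSum (fun x y => br x y) α X
  | 0, _ => ⟨0, fun _ => rfl⟩
  | m + 1, α => by
    let f : S →ₗ[ℝ] S →ₗ[ℝ] S [⋀^Fin m]→ₗ[ℝ] P :=
      (-(1 / 2 : ℝ)) • br.compr₂ (toReal α).curryLeft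
    refine ⟨AlternatingMap.alternatizeUncurryFin (AlternatingMap.alternatizeUncurryFinLM ∘ₗ f),
      fun X => ?_⟩
    rw [AlternatingMap.alternatizeUncurryFin_alternatizeUncurryFinLM_comp_apply]
    refine Finset.sum_congr rfl fun i _ => Finset.sum_congr rfl fun j _ => ?_
    rw [← add_assoc, pow_succ, mul_neg_one, neg_smul, ← smul_neg]
    congr 1
    have h : ∀ x y v, f x y v = (-(1 / 2 : ℝ)) • α (Matrix.vecCons (br x y) v) := fun x y v => rfl
    have h2 : ∀ x v, α (Matrix.vecCons (-x) v) = - α (Matrix.vecCons x v) := fun x v => by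
      have := (toReal α).curryLeft.map_neg x
      exact congrArg (fun g => g v) this
    rw [h, h, hbr (X j.succ), h2]
    module

theorem cartanFormula_cons_smul {br : S → S → S} {D : S → P → P} {act : S → R → R}
    (hbr : ∀ x y, br x y = - br y x)
    (hbr' : ∀ x (f : R) y, br x (f • y) = f • br x y + act x f • y)
    (hD : ∀ (f : R) x p, D (f • x) p = f • D x p)
    (hD' : ∀ x (f : R) p, D x (f • p) = act x f • p + f • D x p) :
    ∀ {k : ℕ} (α : S [⋀^Fin k]→ₗ[R] P) (f : R) (x : S) (v : Fin k → S),
    cartanFormula br D α (Fin.cons (f • x) v) = f • cartanFormula br D α (Fin.cons x v)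
  | 0, α, f, x, v => by
    simp [cartanFormula, derivSum, bracketSum, hD]
  | m + 1, α, f, x, v => by
    have hα : ∀ (y : S) (u : Fin m → S),
        α (Matrix.vecCons (f • y) u) = f • α (Matrix.vecCons y u) :=
      fun y u => α.map_vecCons_smul u f y
    have h1 : derivSum D α (Fin.cons (f • x) v) = f • derivSum D α (Fin.cons x v) +
        ∑ i : Fin (m + 1), (-1 : ℤ) ^ ((i : ℕ) + 1) •
          act (v i) f • α (Matrix.vecCons x (i.removeNth v)) := by
      have hr : ∀ (i : Fin (m + 1)) (y : S), i.succ.removeNth (Fin.cons y v : Fin (m + 2) → S) =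
          Matrix.vecCons y (i.removeNth v) := by
        intro i y
        ext t
        refine Fin.cases ?_ (fun t => ?_) t <;> simp [Fin.removeNth, Matrix.vecCons]
      have h0 : ∀ y : S, (0 : Fin (m + 2)).removeNth (Fin.cons y v : Fin (m + 2) → S) = v := by
        intro y; ext t; simp [Fin.removeNth]
      unfold derivSum
      rw [Fin.sum_univ_succ, Fin.sum_univ_succ (n := m + 1)]
      simp only [hr, h0, hα, hD', hD, Fin.cons_zero, Fin.cons_succ, Fin.val_zero, pow_zero,
        one_smul, Fin.val_succ, smul_add, Finset.sum_add_distrib, Finset.smul_sum]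
      simp only [smul_comm f]
      abel
    have h2 : bracketSum br α (Fin.cons (f • x) v) = f • bracketSum br α (Fin.cons x v) -
        ∑ i : Fin (m + 1), (-1 : ℤ) ^ ((i : ℕ) + 1) •
          act (v i) f • α (Matrix.vecCons x (i.removeNth v)) := by
      have h0 : ∀ y : S, (Fin.castSucc (0 : Fin (m + 1))).removeNth
          (Fin.cons y v : Fin (m + 2) → S) = v := by
        intro y; ext t; simp [Fin.removeNth]
      have hbl : ∀ y, br (f • x) y = f • br x y + (- act y f) • x := by
        intro y; rw [hbr, hbr', hbr x y]; module
      have hadd : ∀ (y z : S) (u : Fin m → S), α (Matrix.vecCons (y + z) u) =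
          α (Matrix.vecCons y u) + α (Matrix.vecCons z u) := fun y z u => α.map_vecCons_add u y z
      have hsm : ∀ (g : R) (y : S) (u : Fin m → S),
          α (Matrix.vecCons (g • y) u) = g • α (Matrix.vecCons y u) :=
        fun g y u => α.map_vecCons_smul u g y
      simp only [bracketSum]
      rw [Fin.sum_univ_succ, Fin.sum_univ_succ (n := m), smul_add, add_sub_right_comm]
      congr 1
      · have hI : Finset.Ici (0 : Fin (m + 1)) = Finset.univ := by ext; simp
        simp only [hI, h0, Finset.smul_sum, ← Finset.sum_sub_distrib]
        refine Finset.sum_congr rfl fun j _ => ?_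
        simp only [Fin.castSucc_zero, Fin.cons_zero, Fin.cons_succ, Fin.val_zero, zero_add]
        rw [hbl, hadd, hsm, hsm, smul_add, neg_smul, smul_neg, smul_comm f, sub_eq_add_neg]
      · simp only [Finset.smul_sum]
        refine Finset.sum_congr rfl fun i _ => Finset.sum_congr rfl fun j hj => ?_
        obtain ⟨j, rfl⟩ : ∃ j', j = Fin.succ j' := Fin.exists_succ_eq.mpr (by
          rintro rfl
          simp at hj) |>.imp fun _ h => h.symm
        obtain ⟨m, rfl⟩ : ∃ m', m = m' + 1 := ⟨m - 1, by have := i.pos; omega⟩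
        have hr : ∀ (y : S) {l : ℕ} (i : Fin (l + 1)) (v : Fin (l + 1) → S),
            i.succ.removeNth (Fin.cons y v : Fin (l + 2) → S) = Fin.cons y (i.removeNth v) := by
          intro y l i v
          ext t
          refine Fin.cases ?_ (fun t => ?_) t <;> simp [Fin.removeNth]
        have hc : ∀ (b : S) (w : Fin m → S), α (Matrix.vecCons b (Fin.cons (f • x) w)) =
            f • α (Matrix.vecCons b (Fin.cons x w)) :=
          fun b w => (α.curryLeft b).map_vecCons_smul w f x
        simp only [← Fin.succ_castSucc, Fin.cons_succ, hr, hc]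
        rw [smul_comm]
    rw [cartanFormula, h1, h2, cartanFormula, smul_add]
    abel

theorem exists_form {br : S →ₗ[ℝ] S →ₗ[ℝ] S} {D : S →ₗ[ℝ] P →ₗ[ℝ] P} {act : S → R → R}
    (hbr : ∀ x y, br x y = - br y x)
    (hbr' : ∀ x (f : R) y, br x (f • y) = f • br x y + act x f • y)
    (hD : ∀ (f : R) x p, D (f • x) p = f • D x p)
    (hD' : ∀ x (f : R) p, D x (f • p) = act x f • p + f • D x p)
    {k : ℕ} (α : S [⋀^Fin k]→ₗ[R] P) :
    ∃ η : S [⋀^Fin (k + 1)]→ₗ[R] P,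
      ∀ X, η X = cartanFormula (fun x y => br x y) (fun x p => D x p) α X := by
  obtain ⟨η₁, h₁⟩ := derivSum_alt D α
  obtain ⟨η₂, h₂⟩ := bracketSum_alt br hbr α
  have h : ∀ X, (η₁ + η₂) X = cartanFormula (fun x y => br x y) (fun x p => D x p) α X :=
    fun X => by rw [cartanFormula, ← h₁, ← h₂]; rfl
  have h0 : ∀ (f : R) (x : S) (v : Fin k → S),
      (η₁ + η₂) (Fin.cons (f • x) v) = f • (η₁ + η₂) (Fin.cons x v) := fun f x v => by
    rw [h, h]
    exact cartanFormula_cons_smul (br := fun x y => br x y) (D := fun x p => D x p)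
      hbr hbr' hD hD' α f x v
  have hs : ∀ (v : Fin (k + 1) → S) (i : Fin (k + 1)) (f : R) (x : S),
      (η₁ + η₂) (Function.update v i (f • x)) = f • (η₁ + η₂) (Function.update v i x) := by
    intro v i f x
    have key : ∀ y, (η₁ + η₂) (Function.update v i y) =
        Equiv.Perm.sign (Equiv.swap 0 i) •
          (η₁ + η₂) (Fin.cons y (Fin.tail (v ∘ Equiv.swap 0 i))) := by
      intro y
      have e : Function.update v i y =
          (Fin.cons y (Fin.tail (v ∘ Equiv.swap 0 i)) : Fin (k + 1) → S) ∘ Equiv.swap 0 i := by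
        have : (Fin.cons y (Fin.tail (v ∘ Equiv.swap 0 i)) : Fin (k + 1) → S) =
            Function.update (v ∘ Equiv.swap 0 i) 0 y := by
          rw [← Fin.cons_self_tail (v ∘ Equiv.swap 0 i), Fin.update_cons_zero, Fin.tail_cons]
        rw [this]
        ext t
        by_cases ht : t = i
        · subst ht; simp
        · have : Equiv.swap 0 i t ≠ 0 := fun hh => ht (by
            have := congrArg (Equiv.swap 0 i) hh; simpa using this)
          simp [ht, this]
      rw [e, AlternatingMap.map_perm]
    rw [key, key, h0, smul_comm]
  refine ⟨{ toFun := fun X => (η₁ + η₂) X, map_update_add' := ?_, map_update_smul' := ?_,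
            map_eq_zero_of_eq' := ?_ }, h⟩
  · intro inst v i x y
    exact (η₁ + η₂).map_update_add v i x y
  · intro inst v i f x
    rw [Subsingleton.elim inst (instDecidableEqFin _)]
    exact hs v i f x
  · exact fun v i j => (η₁ + η₂).map_eq_zero_of_eq v


/-- The properties of a bracket `br`, a covariant derivative `D` and an action `act` on scalars
under which `cartanFormula br D` sends alternating `R`-multilinear maps to such maps. -/
structure IsCartanPair (br : S → S → S) (D : S → P → P) (act : S → R → R) : Prop where
  br_swap : ∀ x y, br x y = - br y x
  br_add : ∀ x y z, br x (y + z) = br x y + br x z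
  br_smul : ∀ x (f : R) y, br x (f • y) = f • br x y + act x f • y
  add_left : ∀ x y p, D (x + y) p = D x p + D y p
  smul_left : ∀ (f : R) x p, D (f • x) p = f • D x p
  add_right : ∀ x p q, D x (p + q) = D x p + D x q
  leibniz : ∀ x (f : R) p, D x (f • p) = act x f • p + f • D x p
  act_const : ∀ x (c : ℝ), act x (algebraMap ℝ R c) = 0

theorem IsCartanPair.real_right {br : S → S → S} {D : S → P → P} {act : S → R → R}
    (h : IsCartanPair br D act) (c : ℝ) (x : S) (p : P) : D x (c • p) = c • D x p := by
  rw [← algebraMap_smul R c p, h.leibniz, h.act_const, zero_smul, zero_add, algebraMap_smul]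

theorem IsCartanPair.br_real {br : S → S → S} {D : S → P → P} {act : S → R → R}
    (h : IsCartanPair br D act) (c : ℝ) (x y : S) : br x (c • y) = c • br x y := by
  rw [← algebraMap_smul R c y, h.br_smul, h.act_const, zero_smul, add_zero, algebraMap_smul]

theorem IsCartanPair.exists_form {br : S → S → S} {D : S → P → P} {act : S → R → R}
    (h : IsCartanPair br D act) {k : ℕ} (α : S [⋀^Fin k]→ₗ[R] P) :
    ∃ η : S [⋀^Fin (k + 1)]→ₗ[R] P, ∀ X, η X = cartanFormula br D α X := by
  let br' : S →ₗ[ℝ] S →ₗ[ℝ] S := LinearMap.mk₂ ℝ br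
    (fun x y z => by rw [h.br_swap, h.br_add, h.br_swap x, h.br_swap y, neg_add])
    (fun c x y => by rw [h.br_swap, h.br_real, h.br_swap x, smul_neg])
    h.br_add (fun c x y => h.br_real c x y)
  let D' : S →ₗ[ℝ] P →ₗ[ℝ] P := LinearMap.mk₂ ℝ D h.add_left
    (fun c x p => by rw [← algebraMap_smul R c x, h.smul_left, algebraMap_smul])
    h.add_right (fun c x p => h.real_right c x p)
  exact Bicomplex.exists_form (br := br') (D := D') h.br_swap h.br_smul h.smul_left h.leibniz α

/-- The operator `α ↦ cartanFormula br D α` on alternating `R`-multilinear maps. -/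
noncomputable def cartanOperator {br : S → S → S} {D : S → P → P} {act : S → R → R}
    (h : IsCartanPair br D act) (k : ℕ) : (S [⋀^Fin k]→ₗ[R] P) →ₗ[ℝ] (S [⋀^Fin (k + 1)]→ₗ[R] P) where
  toFun α :=
    { toFun := cartanFormula br D α
      map_update_add' := fun v i x y => by
        obtain ⟨η, hη⟩ := h.exists_form α
        simp only [← hη]; exact η.map_update_add v i x y
      map_update_smul' := fun v i f x => by
        obtain ⟨η, hη⟩ := h.exists_form α
        simp only [← hη]; exact η.map_update_smul v i f x
      map_eq_zero_of_eq' := fun v i j hv hij => by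
        obtain ⟨η, hη⟩ := h.exists_form α
        simp only [← hη]; exact η.map_eq_zero_of_eq v hv hij }
  map_add' α β := by
    ext X
    cases k <;>
    simp [cartanFormula, derivSum, bracketSum, h.add_right, smul_add, Finset.sum_add_distrib] <;>
    abel
  map_smul' c α := by
    ext X
    cases k <;>
    simp [cartanFormula, derivSum, bracketSum, h.real_right, Finset.smul_sum, smul_comm c, smul_add]

end Alternating

section Manifold

/-- The ring `C^∞(M)` of smooth real functions on an `n`-dimensional manifold `M`. -/
abbrev Fun (n : ℕ) (M : Type*) [TopologicalSpace M] [ChartedSpace (EuclideanSpace ℝ (Fin n)) M] :=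
  C^∞⟮𝓡 n, M; 𝓘(ℝ, ℝ), ℝ⟯

/-- The smooth vector fields on `M`. -/
abbrev VF (n : ℕ) (M : Type*) [TopologicalSpace M] [ChartedSpace (EuclideanSpace ℝ (Fin n)) M]
    [IsManifold (𝓡 n) ∞ M] :=
  Cₛ^∞⟮𝓡 n; EuclideanSpace ℝ (Fin n), (TangentSpace (𝓡 n) : M → Type _)⟯

variable {n : ℕ} {M : Type*} [TopologicalSpace M] [ChartedSpace (EuclideanSpace ℝ (Fin n)) M]
  [IsManifold (𝓡 n) ∞ M]

noncomputable instance : SMul (Fun n M) (VF n M) :=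
  ⟨fun f X => ⟨(f : M → ℝ) • (X : ∀ x, TangentSpace (𝓡 n) x), f.contMDiff.smul_section X.contMDiff⟩⟩

theorem smul_apply (f : Fun n M) (X : VF n M) (x : M) : (f • X) x = f x • X x := rfl

/-- Vector fields form a module over `C^∞(M)` under pointwise multiplication. -/
noncomputable instance : Module (Fun n M) (VF n M) where
  one_smul X := ContMDiffSection.ext fun x => one_smul ℝ (X x)
  mul_smul f g X := ContMDiffSection.ext fun x => mul_smul (f x) (g x) (X x)
  smul_zero f := ContMDiffSection.ext fun x => smul_zero (f x)
  smul_add f X Y := ContMDiffSection.ext fun x => smul_add (f x) (X x) (Y x)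
  add_smul f g X := ContMDiffSection.ext fun x => add_smul (f x) (g x) (X x)
  zero_smul X := ContMDiffSection.ext fun x => zero_smul ℝ (X x)

instance : IsScalarTower ℝ (Fun n M) (VF n M) :=
  ⟨fun c f X => ContMDiffSection.ext fun x => smul_assoc c (f x) (X x)⟩

/-- The derivative `X f` of a function along a vector field. -/
noncomputable def lieFun (X : VF n M) (f : Fun n M) : Fun n M :=
  ⟨fun x => mvfderiv (𝓡 n) f x (X x), by
    have h : ContMDiff (𝓡 n) (𝓘(ℝ, ℝ).tangent) ∞ fun x => tangentMap (𝓡 n) 𝓘(ℝ, ℝ) f ⟨x, X x⟩ :=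
      (f.contMDiff.contMDiff_tangentMap (m := ∞) (by simp)).comp X.contMDiff
    exact (contMDiff_snd_tangentBundle_modelSpace ℝ 𝓘(ℝ, ℝ)).comp h⟩

theorem isManifold_of_le_infty (k : ℕ) : IsManifold (𝓡 n) k M :=
  IsManifold.of_le (n := ∞) (by exact_mod_cast le_top)

/-- The Lie bracket `[X, Y]` of vector fields. -/
noncomputable def bracket (X Y : VF n M) : VF n M :=
  ⟨VectorField.mlieBracket (𝓡 n) X Y, fun x => by
    have : IsManifold (𝓡 n) (minSmoothness ℝ 2) M := by
      simpa using isManifold_of_le_infty (n := n) (M := M) 2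
    have : IsManifold (𝓡 n) (minSmoothness ℝ 3) M := by
      simpa using isManifold_of_le_infty (n := n) (M := M) 3
    have : IsManifold (𝓡 n) (((⊤ : ℕ∞) : ℕ∞ω) + 1) M := by simpa
    exact ContMDiffAt.mlieBracket_vectorField (m := ⊤) (n := ⊤) X.contMDiff.contMDiffAt
      Y.contMDiff.contMDiffAt (by simp)⟩

theorem VF.mdiff (X : VF n M) (x : M) :
    MDifferentiableAt (𝓡 n) ((𝓡 n).prod 𝓘(ℝ, EuclideanSpace ℝ (Fin n)))
      (fun x => (⟨x, X x⟩ : TangentBundle (𝓡 n) M)) x :=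
  X.mdifferentiableAt

theorem Fun.mdiff (f : Fun n M) (x : M) : MDifferentiableAt (𝓡 n) 𝓘(ℝ, ℝ) f x :=
  f.contMDiff.mdifferentiableAt (by simp)

theorem bracket_swap (X Y : VF n M) : bracket X Y = - bracket Y X :=
  ContMDiffSection.ext fun _ => VectorField.mlieBracket_swap_apply

theorem bracket_add (X Y Z : VF n M) : bracket X (Y + Z) = bracket X Y + bracket X Z :=
  ContMDiffSection.ext fun x => by
    have := isManifold_of_le_infty (n := n) (M := M) 2
    exact VectorField.mlieBracket_add_right (Y.mdiff x) (Z.mdiff x)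

theorem bracket_smul (X : VF n M) (f : Fun n M) (Y : VF n M) :
    bracket X (f • Y) = f • bracket X Y + lieFun X f • Y :=
  ContMDiffSection.ext fun x => by
    have := isManifold_of_le_infty (n := n) (M := M) 2
    have := VectorField.mlieBracket_smul_right (V := X) (f.mdiff x) (Y.mdiff x)
    exact this.trans (add_comm _ _)

theorem lieFun_add_left (X Y : VF n M) (f : Fun n M) :
    lieFun (X + Y) f = lieFun X f + lieFun Y f :=
  ContMDiffMap.ext fun x => (mvfderiv (𝓡 n) f x).map_add (X x) (Y x)

theorem lieFun_smul_left (g : Fun n M) (X : VF n M) (f : Fun n M) :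
    lieFun (g • X) f = g • lieFun X f :=
  ContMDiffMap.ext fun x => (mvfderiv (𝓡 n) f x).map_smul (g x) (X x)

theorem lieFun_add (X : VF n M) (f g : Fun n M) : lieFun X (f + g) = lieFun X f + lieFun X g :=
  ContMDiffMap.ext fun x => by
    have := mvfderiv_add (f.mdiff x) (g.mdiff x)
    exact congrArg (fun l => l (X x)) this

theorem lieFun_mul (X : VF n M) (f g : Fun n M) :
    lieFun X (f • g) = lieFun X f • g + f • lieFun X g :=
  ContMDiffMap.ext fun x => by
    have := mvfderiv_mul (f.mdiff x) (g.mdiff x)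
    have := congrArg (fun l => l (X x)) this
    refine this.trans ?_
    change f x * _ + g x * _ = _ * g x + f x * _
    rw [add_comm, mul_comm (g x)]
    rfl

theorem lieFun_const (X : VF n M) (c : ℝ) : lieFun X (algebraMap ℝ (Fun n M) c) = 0 :=
  ContMDiffMap.ext fun x => by
    have := mvfderiv_const (I := 𝓡 n) c (x := x)
    exact congrArg (fun l => l (X x)) this

variable {P : Type*} [AddCommGroup P] [Module (Fun n M) P] [Module ℝ P]
  [IsScalarTower ℝ (Fun n M) P]

/-- `Ω^k(M, P)`: alternating `C^∞(M)`-multilinear maps from vector fields to the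
`C^∞(M)`-module `P` of smooth sections of a vector bundle. For `P = C^∞(M)` these are the
scalar-valued `k`-forms, for `P = VF n M` the `k`-forms with values in `TM`. -/
abbrev Form (n : ℕ) (M : Type*) [TopologicalSpace M] [ChartedSpace (EuclideanSpace ℝ (Fin n)) M]
    [IsManifold (𝓡 n) ∞ M] (P : Type*) [AddCommGroup P] [Module (Fun n M) P] (k : ℕ) :=
  VF n M [⋀^Fin k]→ₗ[Fun n M] P

/-- A connection `(X, s) ↦ ∇_X s` on the sections `P` of a vector bundle over `M`. -/
structure Connection (n : ℕ) (M : Type*) [TopologicalSpace M]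
    [ChartedSpace (EuclideanSpace ℝ (Fin n)) M] [IsManifold (𝓡 n) ∞ M]
    (P : Type*) [AddCommGroup P] [Module (Fun n M) P] where
  /-- The covariant derivative `∇_X s`. -/
  cov : VF n M → P → P
  add_left : ∀ X Y s, cov (X + Y) s = cov X s + cov Y s
  smul_left : ∀ (f : Fun n M) X s, cov (f • X) s = f • cov X s
  add_right : ∀ X s t, cov X (s + t) = cov X s + cov X t
  leibniz : ∀ X (f : Fun n M) s, cov X (f • s) = lieFun X f • s + f • cov X s

/-- The trivial connection `∇_X f = X f` on scalar functions. -/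
noncomputable def Connection.trivial (n : ℕ) (M : Type*) [TopologicalSpace M]
    [ChartedSpace (EuclideanSpace ℝ (Fin n)) M] [IsManifold (𝓡 n) ∞ M] :
    Connection n M (Fun n M) where
  cov := lieFun
  add_left := lieFun_add_left
  smul_left := lieFun_smul_left
  add_right := lieFun_add
  leibniz := lieFun_mul

/-- The connection on `TM`, acting on smooth vector fields, given by a smooth
`CovariantDerivative`. -/
noncomputable def Connection.ofCovariantDerivative
    (nabla : CovariantDerivative (𝓡 n) (EuclideanSpace ℝ (Fin n))
      (TangentSpace (𝓡 n) : M → Type _))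
    (hs : nabla.ContMDiffCovariantDerivative ∞) : Connection n M (VF n M) where
  cov X Z := ⟨fun x => nabla Z x (X x), by
    have h := hs.contMDiff.contMDiff (σ := Z) (by simpa using Z.contMDiff.contMDiffOn)
    exact (contMDiffOn_univ.1 h).clm_bundle_apply X.contMDiff⟩
  add_left X Y Z := ContMDiffSection.ext fun x => (nabla Z x).map_add (X x) (Y x)
  smul_left f X Z := ContMDiffSection.ext fun x => (nabla Z x).map_smul (f x) (X x)
  add_right X Z W := ContMDiffSection.ext fun x =>
    congrArg (fun l => l (X x)) (nabla.isCovariantDerivativeOnUniv.add (Z.mdiff x) (W.mdiff x))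
  leibniz X f Z := ContMDiffSection.ext fun x => by
    have := nabla.isCovariantDerivativeOnUniv.leibniz (Z.mdiff x) (f.mdiff x)
    exact (congrArg (fun l => l (X x)) this).trans (add_comm _ _)

/-- Flatness: the curvature `∇_X ∇_Y - ∇_Y ∇_X - ∇_{[X,Y]}` vanishes. -/
def Connection.IsFlat (D : Connection n M P) : Prop :=
  ∀ X Y s, D.cov X (D.cov Y s) - D.cov Y (D.cov X s) - D.cov (bracket X Y) s = 0

/-- Endomorphisms of `TM`, i.e. (1,1)-tensor fields, as `C^∞(M)`-linear maps on vector fields. -/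
abbrev TangentEnd (n : ℕ) (M : Type*) [TopologicalSpace M]
    [ChartedSpace (EuclideanSpace ℝ (Fin n)) M] [IsManifold (𝓡 n) ∞ M] :=
  Module.End (Fun n M) (VF n M)

/-- The Nijenhuis torsion `[LX, LY] - L[X, LY] - L[LX, Y] + L²[X, Y]` of `L`. -/
noncomputable def nijenhuisTorsion (L : TangentEnd n M) (X Y : VF n M) : VF n M :=
  bracket (L X) (L Y) - L (bracket X (L Y)) - L (bracket (L X) Y) + L (L (bracket X Y))

/-- `L` has zero Nijenhuis torsion. -/
def IsTorsionless (L : TangentEnd n M) : Prop := ∀ X Y, nijenhuisTorsion L X Y = 0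

/-- The deformed bracket `[X, Y]_L = [LX, Y] + [X, LY] - L[X, Y]`. -/
noncomputable def bracketL (L : TangentEnd n M) (X Y : VF n M) : VF n M :=
  bracket (L X) Y + bracket X (L Y) - L (bracket X Y)

theorem bracketL_swap (L : TangentEnd n M) (X Y : VF n M) : bracketL L X Y = - bracketL L Y X := by
  simp only [bracketL, bracket_swap (L X), bracket_swap X, map_neg]
  abel

theorem bracketL_add (L : TangentEnd n M) (X Y Z : VF n M) :
    bracketL L X (Y + Z) = bracketL L X Y + bracketL L X Z := by
  simp only [bracketL, bracket_add, map_add]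
  abel

theorem bracketL_smul (L : TangentEnd n M) (X : VF n M) (f : Fun n M) (Y : VF n M) :
    bracketL L X (f • Y) = f • bracketL L X Y + lieFun (L X) f • Y := by
  simp only [bracketL, bracket_smul, map_add, map_smul, smul_add, smul_sub]
  abel

theorem isCartanPair_nabla (D : Connection n M P) : IsCartanPair bracket D.cov lieFun :=
  ⟨bracket_swap, bracket_add, bracket_smul, D.add_left, D.smul_left, D.add_right, D.leibniz,
    lieFun_const⟩

theorem isCartanPair_L (D : Connection n M P) (L : TangentEnd n M) :
    IsCartanPair (bracketL L) (fun X => D.cov (L X)) (fun X => lieFun (L X)) :=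
  ⟨bracketL_swap L, bracketL_add L, bracketL_smul L, by simp [D.add_left], by simp [D.smul_left],
    fun _ => D.add_right _, fun _ => D.leibniz _, fun _ => lieFun_const _⟩

/-- The exterior covariant derivative `d_∇`:
`(d_∇ α)(X_0, …, X_k) = ∑_i (-1)^i ∇_{X_i} (α(X_0, …, X̂_i, …, X_k))
  + ∑_{i<j} (-1)^{i+j} α([X_i, X_j], X_0, …, X̂_i, …, X̂_j, …, X_k)`. -/
noncomputable def dNabla (D : Connection n M P) (k : ℕ) : Form n M P k →ₗ[ℝ] Form n M P (k + 1) :=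
  cartanOperator (isCartanPair_nabla D) k

/-- The `L`-exterior covariant derivative `d_{L∇}`:
`(d_{L∇} α)(X_0, …, X_k) = ∑_i (-1)^i ∇_{L X_i} (α(X_0, …, X̂_i, …, X_k))
  + ∑_{i<j} (-1)^{i+j} α([X_i, X_j]_L, X_0, …, X̂_i, …, X̂_j, …, X_k)`. -/
noncomputable def dLNabla (D : Connection n M P) (L : TangentEnd n M) (k : ℕ) :
    Form n M P k →ₗ[ℝ] Form n M P (k + 1) :=
  cartanOperator (isCartanPair_L D L) k

/-- The value `(d_L α)(X_0, …, X_k)` for a scalar-valued `k`-form `α`: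
`∑_i (-1)^i (L X_i)(α(X_0, …, X̂_i, …, X_k))
  + ∑_{i<j} (-1)^{i+j} α([X_i, X_j]_L, X_0, …, X̂_i, …, X̂_j, …, X_k)`. -/
noncomputable def dLScalar (L : TangentEnd n M) {k : ℕ} (α : Form n M (Fun n M) k)
    (X : Fin (k + 1) → VF n M) : Fun n M :=
  cartanFormula (bracketL L) (fun X f => lieFun (L X) f) α X

/-- `(Ω^*, d₁, d₂)` is a bidifferential complex: the degree-one operators `d₁`, `d₂` square to
zero and anticommute. -/
structure IsBidifferentialComplex {Om : ℕ → Type*} [∀ k, AddCommGroup (Om k)]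
    [∀ k, Module ℝ (Om k)] (d₁ d₂ : ∀ k, Om k →ₗ[ℝ] Om (k + 1)) : Prop where
  sq_left : ∀ k, d₁ (k + 1) ∘ₗ d₁ k = 0
  sq_right : ∀ k, d₂ (k + 1) ∘ₗ d₂ k = 0
  anticomm : ∀ k, d₁ (k + 1) ∘ₗ d₂ k + d₂ (k + 1) ∘ₗ d₁ k = 0

end Manifold
end Bicomplex

/-! `d_{L∇}` is a Chevalley–Eilenberg differential: its Lie bracket is `[·,·]_L`, and `X ↦ ∇_{LX}`
plays the role of the representation. When the torsion of `L` vanishes, `L` carries `[·,·]_L` to the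
ordinary bracket (`IsTorsionless.map_bracketL`) and `[·,·]_L` satisfies Jacobi
(`IsTorsionless.bracketL_jacobi`). If `∇` is also flat, then `∇_{LX}` is a genuine representation.

The square then vanishes by Cartan calculus. Write `i_x` for contraction (`curryLeft`) and `𝓛_x =
i_x d + d i_x`. An explicit expansion of `i_x d` (`cartanFormula_vecCons_succ`) shows that `𝓛_x` is
the usual Lie derivative, whence `[𝓛_x, i_y] = i_{[x,y]}`. Jacobi and flatness give `𝓛_{[x,y]} =
[𝓛_x, 𝓛_y]` and `𝓛_x d = d 𝓛_x`. Hence `i_x d d = d d i_x`, and induction on the degree finishes.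

Anticommutation follows by polarization: `d_{L∇}` is additive in `L`, so expanding the square of
`d_{(L+N)∇}` leaves only the mixed terms. The pair `I`, `L` is always compatible, because adding `I`
does not change the torsion. -/

namespace Bicomplex

/-! ### Contraction of the Cartan formula. -/

section Formula

variable {R S P : Type*} [CommRing R] [AddCommGroup S] [Module R S] [AddCommGroup P] [Module R P]

theorem removeNth_succ_vecCons {m : ℕ} (x : S) (i : Fin (m + 1)) (v : Fin (m + 1) → S) :
    i.succ.removeNth (Matrix.vecCons x v : Fin (m + 2) → S) =
      Matrix.vecCons x (i.removeNth v) := by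
  ext t
  refine Fin.cases ?_ (fun t => ?_) t <;> simp [Fin.removeNth, Matrix.vecCons]

theorem removeNth_zero_vecCons {m : ℕ} (x : S) (v : Fin m → S) :
    (0 : Fin (m + 1)).removeNth (Matrix.vecCons x v : Fin (m + 1) → S) = v := by
  ext t; simp [Fin.removeNth]

theorem map_vecCons_vecCons_swap {m : ℕ} (α : S [⋀^Fin (m + 2)]→ₗ[R] P) (x y : S)
    (v : Fin m → S) :
    α (Matrix.vecCons x (Matrix.vecCons y v)) = -α (Matrix.vecCons y (Matrix.vecCons x v)) := by
  rw [← α.map_swap _ (Fin.zero_ne_one (n := m))]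
  congr 1
  ext t
  refine Fin.cases ?_ (fun t => Fin.cases ?_ (fun t => ?_) t) t
  · simp
  · simp
  · have h : Equiv.swap (0 : Fin (m + 2)) 1 t.succ.succ = t.succ.succ :=
      Equiv.swap_apply_of_ne_of_ne (Fin.succ_ne_zero _)
        (fun h => Fin.succ_ne_zero t (Fin.succ_injective _ h))
    simp [h]

theorem map_update_eq_vecCons {m : ℕ} (α : S [⋀^Fin (m + 1)]→ₗ[R] P) (v : Fin (m + 1) → S)
    (j : Fin (m + 1)) (y : S) :
    α (Function.update v j y) = (-1 : ℤ) ^ (j : ℕ) • α (Matrix.vecCons y (j.removeNth v)) := by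
  rw [← Fin.insertNth_removeNth, AlternatingMap.map_insertNth]

/-- Cartan's formula for the contraction of `cartanFormula br D α` with `x`, in degree `0`. -/
theorem cartanFormula_vecCons_zero (br : S → S → S) (D : S → P → P) (α : S [⋀^Fin 0]→ₗ[R] P)
    (x : S) (v : Fin 0 → S) :
    cartanFormula br D α (Matrix.vecCons x v) = D x (α v) := by
  simp [cartanFormula, derivSum, bracketSum]

/-- Cartan's formula for the contraction of `cartanFormula br D α` with `x`, in positive
degree. -/
theorem cartanFormula_vecCons_succ {br : S → S → S} {D : S → P → P} {k : ℕ}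
    (α : S [⋀^Fin (k + 1)]→ₗ[R] P) (x : S) (v : Fin (k + 1) → S) :
    cartanFormula br D α (Matrix.vecCons x v) =
      D x (α v) - ∑ j, α (Function.update v j (br x (v j))) -
        cartanFormula br D (α.curryLeft x) v := by
  -- Since `x` is the entry of index `0`, the other indices all rise by one, which flips their sign.
  have h1 : derivSum D α (Matrix.vecCons x v) =
      D x (α v) - derivSum D (α.curryLeft x) v := by
    unfold derivSum
    rw [Fin.sum_univ_succ]
    simp [removeNth_succ_vecCons, pow_succ, sub_eq_add_neg]
  have h2 : bracketSum br α (Matrix.vecCons x v) =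
      - ∑ j, α (Function.update v j (br x (v j))) - bracketSum br (α.curryLeft x) v := by
    simp only [bracketSum]
    rw [Fin.sum_univ_succ, sub_eq_add_neg]
    congr 1
    -- The pairs containing `x`: moving `[x, v_j]` from the front back to slot `j` absorbs `(-1)^j`
    -- and leaves a global minus sign.
    · have hI : Finset.Ici (0 : Fin (k + 1)) = Finset.univ := by ext; simp
      rw [hI, ← Finset.sum_neg_distrib]
      refine Finset.sum_congr rfl fun j _ => ?_
      rw [map_update_eq_vecCons, Fin.castSucc_zero, removeNth_zero_vecCons]
      simp [pow_succ]
    -- In the pairs avoiding `x` both indices rise by one, so the sign is unchanged; the minus comes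
    -- from exchanging `x` with the bracket in front of it.
    · cases k with
      | zero => simp
      | succ k =>
        simp only [← Finset.sum_neg_distrib]
        refine Finset.sum_congr rfl fun i _ => ?_
        have hI : Finset.Ici i.succ = (Finset.Ici i).map (Fin.succEmb (k + 1)) := by
          ext j
          simp
        rw [hI, Finset.sum_map]
        refine Finset.sum_congr rfl fun j _ => ?_
        simp only [Fin.coe_succEmb, ← Fin.succ_castSucc, removeNth_succ_vecCons,
          Matrix.cons_val_succ, Fin.val_succ, AlternatingMap.curryLeft_apply_apply]
        rw [map_vecCons_vecCons_swap, smul_neg]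
        congr 2
        ring
  rw [cartanFormula, h1, h2, cartanFormula]
  abel

end Formula

/-! ### Cartan calculus over the reals. -/

section Square

variable {S P : Type*} [AddCommGroup S] [Module ℝ S] [AddCommGroup P] [Module ℝ P]
  {br : S → S → S} {D : S → P → P} {act : S → ℝ → ℝ}

/-- The Lie derivative along `x` of alternating maps, defined by Cartan's magic formula. -/
noncomputable def lieDerivative (h : IsCartanPair br D act) (x : S) :
    (k : ℕ) → (S [⋀^Fin k]→ₗ[ℝ] P) → (S [⋀^Fin k]→ₗ[ℝ] P)
  | 0, α => (cartanOperator h 0 α).curryLeft x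
  | k + 1, α => (cartanOperator h (k + 1) α).curryLeft x + cartanOperator h k (α.curryLeft x)

/-- The summand `d i_x` of the definition cancels the last term in the expansion of `i_x d`. -/
theorem lieDerivative_apply (h : IsCartanPair br D act) (x : S) (k : ℕ) (α : S [⋀^Fin k]→ₗ[ℝ] P)
    (v : Fin k → S) :
    lieDerivative h x k α v = D x (α v) - ∑ j, α (Function.update v j (br x (v j))) := by
  cases k with
  | zero =>
    refine (cartanFormula_vecCons_zero br D α x v).trans ?_
    simp
  | succ k =>
    change cartanFormula br D α (Matrix.vecCons x v) + cartanFormula br D (α.curryLeft x) v = _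
    rw [cartanFormula_vecCons_succ, sub_add_cancel]

theorem curryLeft_cartanOperator (h : IsCartanPair br D act) (x : S) (k : ℕ)
    (α : S [⋀^Fin (k + 1)]→ₗ[ℝ] P) :
    (cartanOperator h (k + 1) α).curryLeft x =
      lieDerivative h x (k + 1) α - cartanOperator h k (α.curryLeft x) :=
  (add_sub_cancel_right _ _).symm

theorem lieDerivative_sub (h : IsCartanPair br D act) (x : S) (k : ℕ)
    (α β : S [⋀^Fin k]→ₗ[ℝ] P) :
    lieDerivative h x k (α - β) = lieDerivative h x k α - lieDerivative h x k β := by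
  cases k with
  | zero => ext v; simp [lieDerivative]
  | succ k =>
    have hc : (α - β).curryLeft x = α.curryLeft x - β.curryLeft x := rfl
    simp only [lieDerivative, map_sub, hc]
    ext v
    simp only [AlternatingMap.add_apply, AlternatingMap.sub_apply,
      AlternatingMap.curryLeft_apply_apply]
    abel

/-- In the derivation formula for `𝓛_x`, the slot occupied by `y` contributes the term with `[x,y]`;
the remaining terms form `𝓛_x` of the contraction. -/
theorem curryLeft_lieDerivative (h : IsCartanPair br D act) (x y : S) (k : ℕ)
    (α : S [⋀^Fin (k + 1)]→ₗ[ℝ] P) :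
    (lieDerivative h x (k + 1) α).curryLeft y =
      lieDerivative h x k (α.curryLeft y) - α.curryLeft (br x y) := by
  ext v
  simp only [AlternatingMap.sub_apply, AlternatingMap.curryLeft_apply_apply, lieDerivative_apply,
    Fin.sum_univ_succ, Matrix.cons_val_zero, Matrix.cons_val_succ]
  have h0 : Function.update (Matrix.vecCons y v) 0 (br x y) = Matrix.vecCons (br x y) v :=
    Fin.update_cons_zero ..
  have h1 : ∀ j : Fin k, Function.update (Matrix.vecCons y v) j.succ (br x (v j)) =
      Matrix.vecCons y (Function.update v j (br x (v j))) := fun j =>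
    (Fin.cons_update ..).symm
  simp only [h0, h1]
  abel

/-- Contraction lowers the degree, so this reduces the identities below to inductions on the degree.
-/
theorem ext_curryLeft {k : ℕ} {α β : S [⋀^Fin (k + 1)]→ₗ[ℝ] P}
    (h : ∀ x, α.curryLeft x = β.curryLeft x) : α = β := by
  ext v
  have := congrArg (fun γ => γ (Matrix.vecTail v)) (h (Matrix.vecHead v))
  simpa using this

/-- For a Lie bracket and a flat `D`, the Lie derivatives form a representation. -/
theorem lieDerivative_br (h : IsCartanPair br D act)
    (hJ : ∀ x y z, br x (br y z) = br (br x y) z + br y (br x z))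
    (hF : ∀ x y p, D (br x y) p = D x (D y p) - D y (D x p)) (x y : S) :
    ∀ (k : ℕ) (α : S [⋀^Fin k]→ₗ[ℝ] P), lieDerivative h (br x y) k α =
      lieDerivative h x k (lieDerivative h y k α) - lieDerivative h y k (lieDerivative h x k α)
  | 0, α => by
    ext v
    simp [lieDerivative_apply, hF]
  | k + 1, α => by
    refine ext_curryLeft fun z => ?_
    have hc : ∀ β γ : S [⋀^Fin (k + 1)]→ₗ[ℝ] P,
      (β - γ).curryLeft z = β.curryLeft z - γ.curryLeft z := fun _ _ => rfl
    -- Jacobi accounts for the terms left over when the contraction with `z` is moved past the Lie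
    -- derivatives.
    have hz : br (br x y) z = br x (br y z) - br y (br x z) := by rw [hJ x]; abel
    simp only [hc, curryLeft_lieDerivative, lieDerivative_sub, hz, map_sub,
      lieDerivative_br h hJ hF x y k]
    abel

/-- Contract with `y` and replace `i_y d` by `𝓛_y - d i_y`: the representation property and the case
of degree one less remain. -/
theorem lieDerivative_cartanOperator (h : IsCartanPair br D act)
    (hJ : ∀ x y z, br x (br y z) = br (br x y) z + br y (br x z))
    (hF : ∀ x y p, D (br x y) p = D x (D y p) - D y (D x p)) (x : S) :
    ∀ (k : ℕ) (α : S [⋀^Fin k]→ₗ[ℝ] P), lieDerivative h x (k + 1) (cartanOperator h k α) =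
      cartanOperator h k (lieDerivative h x k α)
  | 0, α => by
    refine ext_curryLeft fun y => ?_
    rw [curryLeft_lieDerivative]
    -- In degree `0`, `i_y d` is `𝓛_y` by definition.
    change lieDerivative h x 0 (lieDerivative h y 0 α) - lieDerivative h (br x y) 0 α =
      lieDerivative h y 0 (lieDerivative h x 0 α)
    rw [lieDerivative_br h hJ hF]
    abel
  | k + 1, α => by
    refine ext_curryLeft fun y => ?_
    rw [curryLeft_lieDerivative]
    simp only [curryLeft_cartanOperator, curryLeft_lieDerivative, lieDerivative_sub, map_sub,
      lieDerivative_cartanOperator h hJ hF x k, lieDerivative_br h hJ hF]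
    abel

/-- `i_x d d = 𝓛_x d - d i_x d = d (𝓛_x - i_x d) = d d i_x`, which vanishes by induction; in degree
`0` already `𝓛_x = i_x d`. -/
theorem cartanOperator_cartanOperator (h : IsCartanPair br D act)
    (hJ : ∀ x y z, br x (br y z) = br (br x y) z + br y (br x z))
    (hF : ∀ x y p, D (br x y) p = D x (D y p) - D y (D x p)) :
    ∀ (k : ℕ) (α : S [⋀^Fin k]→ₗ[ℝ] P), cartanOperator h (k + 1) (cartanOperator h k α) = 0
  | 0, α => by
    refine ext_curryLeft fun x => ?_
    rw [curryLeft_cartanOperator, lieDerivative_cartanOperator h hJ hF]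
    exact sub_self _
  | k + 1, α => by
    refine ext_curryLeft fun x => ?_
    rw [curryLeft_cartanOperator, lieDerivative_cartanOperator h hJ hF, curryLeft_cartanOperator,
      map_sub, cartanOperator_cartanOperator h hJ hF k]
    simp

end Square

/-! ### Reduction from `R`-multilinear to real multilinear maps. -/

section Alternating

variable {R S P : Type*} [CommRing R] [Algebra ℝ R]
  [AddCommGroup S] [Module R S] [Module ℝ S] [IsScalarTower ℝ R S]
  [AddCommGroup P] [Module R P] [Module ℝ P] [IsScalarTower ℝ R P]
  {br : S → S → S} {D : S → P → P} {act : S → R → R}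

/-- Real constants have zero derivative, so the action on scalars becomes zero. -/
theorem IsCartanPair.restrictScalars (h : IsCartanPair br D act) :
    IsCartanPair (R := ℝ) br D (fun _ _ => 0) where
  br_swap := h.br_swap
  br_add := h.br_add
  br_smul x c y := by rw [h.br_real, zero_smul, add_zero]
  add_left := h.add_left
  smul_left c x p := by rw [← algebraMap_smul R c x, h.smul_left, algebraMap_smul]
  add_right := h.add_right
  leibniz x c p := by rw [h.real_right, zero_smul, zero_add]
  act_const _ _ := rfl

theorem cartanOperator_comp_self (h : IsCartanPair br D act)
    (hJ : ∀ x y z, br x (br y z) = br (br x y) z + br y (br x z))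
    (hF : ∀ x y p, D (br x y) p = D x (D y p) - D y (D x p)) (k : ℕ) :
    cartanOperator h (k + 1) ∘ₗ cartanOperator h k = 0 := by
  ext α X
  -- Restricting scalars does not change the values of a form or of its Cartan formula.
  exact congrArg (fun β => β X)
    (cartanOperator_cartanOperator h.restrictScalars hJ hF k (toReal α))

end Alternating

/-! ### The deformed bracket of a torsionless endomorphism. -/

section Manifold

variable {n : ℕ} {M : Type*} [TopologicalSpace M] [ChartedSpace (EuclideanSpace ℝ (Fin n)) M]
  [IsManifold (𝓡 n) ∞ M]

theorem bracket_jacobi (X Y Z : VF n M) :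
    bracket X (bracket Y Z) = bracket (bracket X Y) Z + bracket Y (bracket X Z) :=
  ContMDiffSection.ext fun x => by
    have : IsManifold (𝓡 n) (minSmoothness ℝ 3) M := by
      simpa using isManifold_of_le_infty (n := n) (M := M) 3
    have hle : ∀ k : ℕ, (k : ℕ∞ω) ≤ ∞ := fun k => by exact_mod_cast le_top
    have h : minSmoothness ℝ 2 ≤ ∞ := by simpa using hle 2
    exact VectorField.leibniz_identity_mlieBracket_apply (X.contMDiff.contMDiffAt.of_le h)
      (Y.contMDiff.contMDiffAt.of_le h) (Z.contMDiff.contMDiffAt.of_le h)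

theorem bracket_add_left (X Y Z : VF n M) : bracket (X + Y) Z = bracket X Z + bracket Y Z := by
  rw [bracket_swap, bracket_add, bracket_swap X, bracket_swap Y, neg_add]

theorem bracket_neg (X Y : VF n M) : bracket X (-Y) = -bracket X Y :=
  map_neg (AddMonoidHom.mk' (bracket X) (bracket_add X)) Y

theorem bracket_sub (X Y Z : VF n M) : bracket X (Y - Z) = bracket X Y - bracket X Z := by
  rw [sub_eq_add_neg, bracket_add, bracket_neg, sub_eq_add_neg]

theorem IsTorsionless.map_bracketL {L : TangentEnd n M} (hL : IsTorsionless L) (X Y : VF n M) :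
    L (bracketL L X Y) = bracket (L X) (L Y) := by
  have h := hL X Y
  rw [nijenhuisTorsion] at h
  rw [bracketL, map_sub, map_add, eq_comm, ← sub_eq_zero, ← h]
  abel

theorem IsTorsionless.bracketL_jacobi {L : TangentEnd n M} (hL : IsTorsionless L)
    (X Y Z : VF n M) :
    bracketL L X (bracketL L Y Z) =
      bracketL L (bracketL L X Y) Z + bracketL L Y (bracketL L X Z) := by
  have e : ∀ U V W : VF n M, bracketL L U (bracketL L V W) =
      bracket (L U) (bracket (L V) W) + bracket (L U) (bracket V (L W)) +
        bracket U (bracket (L V) (L W)) - L (bracket U (bracket (L V) W)) -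
        L (bracket U (bracket V (L W))) - L (bracket (L U) (bracket V W)) +
        L (L (bracket U (bracket V W))) := fun U V W => by
    -- The torsion at `(U, [V, W])` removes the two terms in which `L[V, W]` sits inside another
    -- bracket.
    have h := hL U (bracket V W)
    rw [nijenhuisTorsion] at h
    rw [bracketL, hL.map_bracketL, bracketL]
    simp only [bracket_add, bracket_sub, map_add, map_sub]
    rw [← sub_eq_zero, ← neg_eq_zero, ← h]
    abel
  rw [bracketL_swap L (bracketL L X Y) Z, e, e, e]
  -- By `e`, the claim is a sum of ordinary Jacobi identities: `L` falls on two arguments, or on one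
  -- with `L` applied outside, or on none with `L²` outside.
  have j1 := bracket_jacobi (L X) (L Y) Z
  have j2 := bracket_jacobi (L X) Y (L Z)
  have j3 := bracket_jacobi X (L Y) (L Z)
  have k1 := congrArg L (bracket_jacobi (L X) Y Z)
  have k2 := congrArg L (bracket_jacobi X (L Y) Z)
  have k3 := congrArg L (bracket_jacobi X Y (L Z))
  have l := congrArg (fun U => L (L U)) (bracket_jacobi X Y Z)
  rw [bracket_swap (bracket _ _)] at j1 j2 j3 k1 k2 k3 l
  simp only [map_add, map_neg] at k1 k2 k3 l
  rw [j1, j2, j3, k1, k2, k3, l]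
  abel

theorem isTorsionless_id : IsTorsionless (LinearMap.id : TangentEnd n M) := fun X Y => by
  simp only [nijenhuisTorsion, LinearMap.id_apply]
  abel

/-- All terms of the torsion of `I + L` that involve `I` cancel. -/
theorem IsTorsionless.id_add {L : TangentEnd n M} (hL : IsTorsionless L) :
    IsTorsionless (LinearMap.id + L) := fun X Y => by
  rw [← hL X Y]
  simp only [nijenhuisTorsion, LinearMap.add_apply, LinearMap.id_apply, bracket_add,
    bracket_add_left, map_add]
  abel

theorem bracketL_id : bracketL (LinearMap.id : TangentEnd n M) = bracket := by
  ext1 X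
  ext1 Y
  simp [bracketL]

theorem bracketL_add_end (L N : TangentEnd n M) (X Y : VF n M) :
    bracketL (L + N) X Y = bracketL L X Y + bracketL N X Y := by
  simp only [bracketL, LinearMap.add_apply, bracket_add, bracket_add_left]
  abel

/-! ### The operators `d_{L∇}`. -/

variable {P : Type*} [AddCommGroup P] [Module (Fun n M) P] [Module ℝ P]
  [IsScalarTower ℝ (Fun n M) P]

theorem dLNabla_id (D : Connection n M P) (k : ℕ) :
    dLNabla D LinearMap.id k = dNabla D k := by
  ext α X
  change cartanFormula (bracketL LinearMap.id) D.cov α X = cartanFormula bracket D.cov α X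
  rw [bracketL_id]

theorem dLNabla_add (D : Connection n M P) (L N : TangentEnd n M) (k : ℕ) :
    dLNabla D (L + N) k = dLNabla D L k + dLNabla D N k := by
  ext α X
  change cartanFormula (bracketL (L + N)) (fun X => D.cov ((L + N) X)) α X =
    cartanFormula (bracketL L) (fun X => D.cov (L X)) α X +
      cartanFormula (bracketL N) (fun X => D.cov (N X)) α X
  have h1 : derivSum (fun X => D.cov ((L + N) X)) α X =
      derivSum (fun X => D.cov (L X)) α X + derivSum (fun X => D.cov (N X)) α X := by
    simp [derivSum, D.add_left, Finset.sum_add_distrib]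
  have h2 : bracketSum (bracketL (L + N)) α X =
      bracketSum (bracketL L) α X + bracketSum (bracketL N) α X := by
    cases k with
    | zero => simp [bracketSum]
    | succ k =>
      simp only [bracketSum, bracketL_add_end, ← Finset.sum_add_distrib, ← smul_add]
      refine Finset.sum_congr rfl fun i _ => Finset.sum_congr rfl fun j _ => ?_
      exact congrArg _ (α.map_vecCons_add ..)
  rw [cartanFormula, h1, h2, cartanFormula, cartanFormula]
  abel

theorem dLNabla_comp_self {D : Connection n M P} (hD : D.IsFlat) {L : TangentEnd n M}
    (hL : IsTorsionless L) (k : ℕ) : dLNabla D L (k + 1) ∘ₗ dLNabla D L k = 0 := by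
  refine cartanOperator_comp_self (isCartanPair_L D L) hL.bracketL_jacobi (fun X Y s => ?_) k
  -- What remains is the curvature of `∇` evaluated at `(LX, LY)`.
  rw [hL.map_bracketL, eq_comm, ← sub_eq_zero]
  exact hD (L X) (L Y) s

theorem isBidifferentialComplex_dLNabla {D : Connection n M P} (hD : D.IsFlat)
    {L N : TangentEnd n M} (hL : IsTorsionless L) (hN : IsTorsionless N)
    (hLN : IsTorsionless (L + N)) : IsBidifferentialComplex (dLNabla D L) (dLNabla D N) where
  sq_left := dLNabla_comp_self hD hL
  sq_right := dLNabla_comp_self hD hN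
  anticomm k := by
    -- Polarization: the pure squares drop out of the expanded square of the sum.
    have h := dLNabla_comp_self hD hLN k
    rw [dLNabla_add, dLNabla_add, LinearMap.add_comp, LinearMap.comp_add, LinearMap.comp_add,
      dLNabla_comp_self hD hL, dLNabla_comp_self hD hN, zero_add, add_zero] at h
    exact h

theorem isBidifferentialComplex_dNabla_dLNabla {D : Connection n M P} (hD : D.IsFlat)
    {L : TangentEnd n M} (hL : IsTorsionless L) :
    IsBidifferentialComplex (dNabla D) (dLNabla D L) := by
  have h := isBidifferentialComplex_dLNabla hD isTorsionless_id hL hL.id_add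
  rwa [show dLNabla D LinearMap.id = dNabla D from funext (dLNabla_id D)] at h

theorem dLNabla_zero_apply (D : Connection n M P) (L : TangentEnd n M) (s : P) (X : VF n M) :
    dLNabla D L 0 (AlternatingMap.constOfIsEmpty _ _ (Fin 0) s) (fun _ => X) =
      D.cov (L X) s := by
  change cartanFormula _ _ _ _ = _
  simp [cartanFormula, derivSum, bracketSum]

end Manifold

end Bicomplex

theorem mainTheorem4 {n : ℕ} {M : Type*} [TopologicalSpace M] [T2Space M]
    [ChartedSpace (EuclideanSpace ℝ (Fin n)) M] [IsManifold (𝓡 n) ∞ M]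
    (nabla : CovariantDerivative (𝓡 n) (EuclideanSpace ℝ (Fin n))
      (TangentSpace (𝓡 n) : M → Type _))
    (hs : nabla.ContMDiffCovariantDerivative ∞)
    (D : Bicomplex.Connection n M (Bicomplex.VF n M))
    (hD : D = Bicomplex.Connection.ofCovariantDerivative nabla hs) :
    -- on scalar-valued forms the operator is `d_L`
    (∀ (L : Bicomplex.TangentEnd n M) (k : ℕ) (α : Bicomplex.Form n M (Bicomplex.Fun n M) k)
      (X : Fin (k + 1) → Bicomplex.VF n M),
      Bicomplex.dLNabla (Bicomplex.Connection.trivial n M) L k α X =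
        Bicomplex.dLScalar L α X) ∧
    -- on a vector field `Z`, seen as a `0`-form, it is `X ↦ ∇_{LX} Z`
    (∀ (L : Bicomplex.TangentEnd n M) (Z X : Bicomplex.VF n M),
      Bicomplex.dLNabla D L 0 (AlternatingMap.constOfIsEmpty _ _ (Fin 0) Z) (fun _ => X) =
        D.cov (L X) Z) ∧
    -- for the identity endomorphism it is `d_∇`
    (∀ k : ℕ, Bicomplex.dLNabla D LinearMap.id k = Bicomplex.dNabla D k) ∧
    -- it squares to zero if `∇` is flat and `L` is torsionless
    (∀ L : Bicomplex.TangentEnd n M, D.IsFlat → Bicomplex.IsTorsionless L →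
      ∀ k : ℕ, Bicomplex.dLNabla D L (k + 1) ∘ₗ Bicomplex.dLNabla D L k = 0) ∧
    -- it is additive in the endomorphism
    (∀ (L N : Bicomplex.TangentEnd n M) (k : ℕ),
      Bicomplex.dLNabla D (L + N) k = Bicomplex.dLNabla D L k + Bicomplex.dLNabla D N k) ∧
    -- the bidifferential complex of two compatible torsionless endomorphisms
    (∀ L N : Bicomplex.TangentEnd n M, D.IsFlat → Bicomplex.IsTorsionless L →
      Bicomplex.IsTorsionless N → Bicomplex.IsTorsionless (L + N) →
      Bicomplex.IsBidifferentialComplex (Bicomplex.dLNabla D L) (Bicomplex.dLNabla D N)) ∧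
    -- the special case of the identity and one torsionless endomorphism
    (∀ L : Bicomplex.TangentEnd n M, D.IsFlat → Bicomplex.IsTorsionless L →
      Bicomplex.IsBidifferentialComplex (Bicomplex.dNabla D) (Bicomplex.dLNabla D L)) := by
  exact ⟨fun _ _ _ _ => rfl, Bicomplex.dLNabla_zero_apply D, Bicomplex.dLNabla_id D,
    fun _ h hL => Bicomplex.dLNabla_comp_self h hL, Bicomplex.dLNabla_add D,
    fun _ _ h hL hN hLN => Bicomplex.isBidifferentialComplex_dLNabla h hL hN hLN,
    fun _ h hL => Bicomplex.isBidifferentialComplex_dNabla_dLNabla h hL⟩
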